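/- Let $m\ge 1$. Let $D([0,1]^m)$ be the space of all functions $f:[0,1]^m\to\mathbb R$ such that, for every $t=(t_1,\dots,t_m)\in[0,1]^m$, the limit of $f(s)$ as $s\to t$ exists as a finite real number along every octant $J_1\times\dots\times J_m$, where each $J_i$ is either $[t_i,1]$ or $[0,t_i)$ (the latter only if $t_i>0$). Equip $D([0,1]^m)$ with the norm $\|f\|=\sup_{t\in[0,1]^m}|f(t)|$ and with the $\sigma$-field $\mathcal D$ generated by all point evaluations $f\mapsto f(t)$, $t\in[0,1]^m$. Then the following hold. (i) For every $\ell\ge1$, every bounded multilinear form $\Upsilon:\bigl(D([0,1]^m)\bigr)^\ell\to\mathbb R$ (that is, every real multilinear form for which there is a constant $C$ with $|\Upsilon(f_1,\dots,f_\ell)|\le C\,\|f_1\|\cdots\|f_\ell\|$ for all $f_1,\dots,f_\ell$) is measurable with respect to the product $\sigma$-field $\mathcal D^{\otimes\ell}$ on $\bigl(D([0,1]^m)\bigr)^\ell$. (ii) Every continuous linear functional on $D([0,1]^m)$ is $\mathcal D$-measurable. (iii) $\mathcal D$ coincides with the $\sigma$-field on $D([0,1]^m)$ generated by the continuous linear functionals.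 (iv) If $X:\Omega\to D([0,1]^m)$ is a function defined on a probability space $(\Omega,\mathcal F,P)$, then $X$ is $\mathcal D$-measurable (that is, a random variable in $D([0,1]^m)$) if and only if $X$ is weakly measurable, that is, $\omega\mapsto\chi(X(\omega))$ is $\mathcal F$-measurable for every continuous linear functional $\chi$ on $D([0,1]^m)$. -/

import Mathlib

open Set Filter Topology MeasureTheory

noncomputable section

namespace CadlagCube

/-- The cube `[0,1]^m`. -/
abbrev Cube (m : ℕ) : Type := Fin m → unitInterval

/-- The octant at `t`: the product of the intervals `[0, t i)` for `i ∈ J` and `[t i, 1]` for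
`i ∉ J`. -/
def octant {m : ℕ} (t : Cube m) (J : Finset (Fin m)) : Set (Cube m) :=
  {s | ∀ i, (i ∈ J → s i < t i) ∧ (i ∉ J → t i ≤ s i)}

/-- At every point, `f` has a finite limit along every octant; an interval `[0, t i)` is used only
if `t i > 0`. -/
def IsCadlag {m : ℕ} (f : Cube m → ℝ) : Prop :=
  ∀ (t : Cube m) (J : Finset (Fin m)), (∀ i ∈ J, 0 < t i) →
    ∃ l : ℝ, Tendsto f (𝓝[octant t J] t) (𝓝 l)

/-- The linear space of the functions on `[0,1]^m` with limits along all octants. -/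
def cadlagSubmodule (m : ℕ) : Submodule ℝ (Cube m → ℝ) where
  carrier := {f | IsCadlag f}
  add_mem' := by
    intro f g hf hg t J hJ
    obtain ⟨a, ha⟩ := hf t J hJ
    obtain ⟨b, hb⟩ := hg t J hJ
    exact ⟨a + b, ha.add hb⟩
  zero_mem' := fun _ _ _ => ⟨0, tendsto_const_nhds⟩
  smul_mem' := by
    intro c f hf t J hJ
    obtain ⟨a, ha⟩ := hf t J hJ
    exact ⟨c * a, ha.const_mul c⟩

/-- The space `D([0,1]^m)`. It is a type of its own, so that it does not inherit the topology of
pointwise convergence. -/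
def D (m : ℕ) : Type := cadlagSubmodule m

namespace D

variable {m : ℕ}

instance : AddCommGroup (D m) := inferInstanceAs (AddCommGroup (cadlagSubmodule m))

instance : Module ℝ (D m) := inferInstanceAs (Module ℝ (cadlagSubmodule m))

instance : FunLike (D m) (Cube m) ℝ where
  coe f := f.1
  coe_injective := Subtype.val_injective

/-- Build an element of `D([0,1]^m)` from a function. -/
def mk (f : Cube m → ℝ) (hf : IsCadlag f) : D m := ⟨f, hf⟩

@[simp] theorem mk_apply (f : Cube m → ℝ) (hf : IsCadlag f) (t : Cube m) : mk f hf t = f t := rfl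

theorem isCadlag (f : D m) : IsCadlag (f : Cube m → ℝ) := f.2

@[ext] theorem ext {f g : D m} (h : ∀ t, f t = g t) : f = g := DFunLike.ext f g h

@[simp] theorem zero_apply (t : Cube m) : (0 : D m) t = 0 := rfl

@[simp] theorem add_apply (f g : D m) (t : Cube m) : (f + g) t = f t + g t := rfl

@[simp] theorem neg_apply (f : D m) (t : Cube m) : (-f) t = -f t := rfl

@[simp] theorem smul_apply (c : ℝ) (f : D m) (t : Cube m) : (c • f) t = c * f t := rfl

/-- Functions in `D([0,1]^m)` are bounded. -/
theorem exists_bound (f : D m) : ∃ C : ℝ, ∀ t, |f t| ≤ C := by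
  have key : ∃ C : ℝ, ∀ t ∈ (univ : Set (Cube m)), |f t| ≤ C := by
    refine isCompact_univ.induction_on (p := fun S => ∃ C : ℝ, ∀ t ∈ S, |f t| ≤ C)
      ⟨0, by simp⟩ ?_ ?_ ?_
    · rintro S T hST ⟨C, hC⟩
      exact ⟨C, fun t ht => hC t (hST ht)⟩
    · rintro S T ⟨C, hC⟩ ⟨C', hC'⟩
      refine ⟨max C C', ?_⟩
      rintro t (ht | ht)
      · exact (hC t ht).trans (le_max_left _ _)
      · exact (hC' t ht).trans (le_max_right _ _)
    · intro t _
      have h1 : ∀ J : Finset (Fin m),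
          ∃ C : ℝ, ∀ᶠ s in 𝓝 t, s ∈ octant t J → |f s| ≤ C := by
        intro J
        by_cases hJ : ∀ i ∈ J, 0 < t i
        · obtain ⟨l, hl⟩ := f.isCadlag t J hJ
          refine ⟨|l| + 1, eventually_nhdsWithin_iff.mp ?_⟩
          exact (hl.abs.eventually (gt_mem_nhds (lt_add_one |l|))).mono fun s hs => hs.le
        · push Not at hJ
          obtain ⟨i, hi, hti⟩ := hJ
          refine ⟨0, Eventually.of_forall fun s hs => ?_⟩
          have h0 : (0 : unitInterval) ≤ s i := unitInterval.nonneg'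
          exact absurd ((hs i).1 hi) (not_lt.mpr (hti.trans h0))
      choose C hC using h1
      refine ⟨{s | ∀ J, s ∈ octant t J → |f s| ≤ C J},
        mem_nhdsWithin_of_mem_nhds (eventually_all.mpr hC), ∑ J, |C J|, ?_⟩
      intro s hs
      classical
      have hmem : s ∈ octant t (Finset.univ.filter fun i => s i < t i) := by
        intro i
        simp
      exact ((hs _ hmem).trans (le_abs_self _)).trans
        (Finset.single_le_sum (f := fun J => |C J|) (fun J _ => abs_nonneg _) (Finset.mem_univ _))
  obtain ⟨C, hC⟩ := key
  exact ⟨C, fun t => hC t (mem_univ t)⟩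

/-- The supremum norm. -/
instance : Norm (D m) := ⟨fun f => ⨆ t : Cube m, |f t|⟩

theorem norm_def (f : D m) : ‖f‖ = ⨆ t : Cube m, |f t| := rfl

theorem abs_apply_le_norm (f : D m) (t : Cube m) : |f t| ≤ ‖f‖ := by
  obtain ⟨C, hC⟩ := f.exists_bound
  exact le_ciSup (f := fun t => |f t|) ⟨C, by rintro _ ⟨s, rfl⟩; exact hC s⟩ t

theorem norm_le {f : D m} {C : ℝ} (h : ∀ t, |f t| ≤ C) : ‖f‖ ≤ C := ciSup_le h

/-- The supremum norm as a group norm. -/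
def groupNorm (m : ℕ) : AddGroupNorm (D m) where
  toFun f := ‖f‖
  map_zero' := by simp [norm_def]
  add_le' f g := norm_le fun t =>
    (abs_add_le (f t) (g t)).trans (add_le_add (abs_apply_le_norm f t) (abs_apply_le_norm g t))
  neg' f := by simp [norm_def]
  eq_zero_of_map_eq_zero' f hf := by
    ext t
    have h : |f t| ≤ 0 := (abs_apply_le_norm f t).trans (le_of_eq hf)
    simpa using h

instance : NormedAddCommGroup (D m) := (groupNorm m).toNormedAddCommGroup

instance : NormedSpace ℝ (D m) where
  norm_smul_le c f := norm_le fun t => by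
    rw [smul_apply, abs_mul, Real.norm_eq_abs]
    exact mul_le_mul_of_nonneg_left (abs_apply_le_norm f t) (abs_nonneg c)

/-- The σ-field on `D([0,1]^m)` generated by the point evaluations `f ↦ f t`. -/
instance measurableSpace : MeasurableSpace (D m) :=
  ⨆ t : Cube m, MeasurableSpace.comap (fun f : D m => f t) (borel ℝ)

end D

/-- The σ-field on a real normed space generated by the continuous linear functionals. -/
abbrev weakSigmaField (B : Type*) [NormedAddCommGroup B] [NormedSpace ℝ B] : MeasurableSpace B :=
  ⨆ χ : StrongDual ℝ B, MeasurableSpace.comap (fun f : B => χ f) (borel ℝ)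

/-- A map into a real normed space is weakly measurable if its composition with every continuous
linear functional is measurable. -/
def WeaklyMeasurable {Ω : Type*} [MeasurableSpace Ω] {B : Type*} [NormedAddCommGroup B]
    [NormedSpace ℝ B] (X : Ω → B) : Prop :=
  ∀ χ : StrongDual ℝ B, Measurable fun ω => χ (X ω)

/-- A multilinear form on a real normed space is bounded if `|Υ(f₁, …, f_ℓ)| ≤ C ‖f₁‖ ⋯ ‖f_ℓ‖`
for some constant `C`. -/
def IsBoundedMultilinear {ℓ : ℕ} {B : Type*} [NormedAddCommGroup B] [NormedSpace ℝ B]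
    (Υ : MultilinearMap ℝ (fun _ : Fin ℓ => B) ℝ) : Prop :=
  ∃ C : ℝ, ∀ f : Fin ℓ → B, |Υ f| ≤ C * ∏ j, ‖f j‖

end CadlagCube

end

/-!
Parts (ii), (iii) and (iv) follow from part (i) with `ℓ = 1`, since point evaluations are continuous
linear functionals. Part (i) is proved by sampling: for a finite set `P` of grid points containing
`0`, the function `sample P f` takes at `s` the value of `f` at `s` rounded down to `P` in every
coordinate. It depends linearly on finitely many values of `f`
(`exists_sample_eq_sum`), so a multilinear form of sampled functions is measurable
(`measurable_form_sample_grid`). It remains to recover `Υ f` from forms of sampled functions by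
countably many pointwise limits.

Let the grids increase to a countable dense set `Q` and sample one coordinate of one argument.
Since tensor products of step functions span a dense subspace (`dense_span_range_tensor`,
`dense_span_range_step`), only the case that this argument is a tensor product whose factor in this
coordinate is an indicator function of `[a, 1]` matters. Sampling turns `[a, 1]` into `[c, 1]` with
`c` the first grid point in `[a, 1]`. If `a ∈ Q`, then `c = a` in the end; otherwise the error tends
to minus the mass `jump a` that the form, as a functional of that factor, puts on the point `a`. So the
sampled forms converge (`tendsto_form_sample`), provided that `Q` contains all `a` whose mass is not
zero for *some* choice of the other factors. Taking one such limit for each coordinate of each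
argument gives the measurability of `Υ`.

The heart of the matter is that the set of these `a` is countable although the other factors range
over an uncountable set (`countable_setOf_jump_ne_zero`). For a family of elements `e` of the bidual
of a normed space `X` whose signed finite sums are bounded, applying `e` to one variable of a form
`Ψ` gives forms whose signed finite sums are bounded as well; in a Hilbert space, such a family is
square summable by the parallelogram law. If the family separates the points of the dual of `X`, it
follows by induction on the number of variables that the space of bounded multilinear forms has an
injective bounded linear map into a Hilbert space (`exists_injective_to_hilbert`). Applying this map
to the contractions of `Ψ`, one sees that only countably many of them are nonzero
(`countable_setOf_bidual_ne_zero`). For `X = D([0,1])` such a family consists of the masses of all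
points and of the evaluations at the indicator functions of `[q, 1]`, with `q` in a countable dense
set, scaled to be summable: a functional without atoms is determined by the latter.
-/

noncomputable section

namespace CadlagCube

/-! ### Unconditionally bounded families and multilinear forms -/

/-- All finite sums `∑ i ∈ F, ε i • v i` with coefficients `|ε i| ≤ 1` have norm at most `K`. By
convexity, it would be the same to allow only the coefficients `±1`. -/
def UnconditionallyBounded {σ Y : Type*} [NormedAddCommGroup Y] [NormedSpace ℝ Y]
    (v : σ → Y) (K : ℝ) : Prop :=
  ∀ (F : Finset σ) (ε : σ → ℝ), (∀ i, |ε i| ≤ 1) → ‖∑ i ∈ F, ε i • v i‖ ≤ K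

theorem UnconditionallyBounded.nonneg {σ Y : Type*} [NormedAddCommGroup Y] [NormedSpace ℝ Y]
    {v : σ → Y} {K : ℝ} (hv : UnconditionallyBounded v K) : 0 ≤ K :=
  (norm_nonneg _).trans (hv ∅ 0 (by simp))

theorem UnconditionallyBounded.map {σ Y Z : Type*} [NormedAddCommGroup Y]
    [NormedSpace ℝ Y] [NormedAddCommGroup Z] [NormedSpace ℝ Z] {v : σ → Y} {K : ℝ}
    (hv : UnconditionallyBounded v K) (T : Y →L[ℝ] Z) :
    UnconditionallyBounded (fun i => T (v i)) (‖T‖ * K) := by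
  intro F ε hε
  have h : ∑ i ∈ F, ε i • T (v i) = T (∑ i ∈ F, ε i • v i) := by simp [map_sum]
  rw [h]
  exact (T.le_opNorm _).trans (mul_le_mul_of_nonneg_left (hv F ε hε) (norm_nonneg _))

theorem UnconditionallyBounded.sumElim {σ τ Y : Type*} [NormedAddCommGroup Y] [NormedSpace ℝ Y]
    {v : σ → Y} {w : τ → Y} {K L : ℝ} (hv : UnconditionallyBounded v K)
    (hw : UnconditionallyBounded w L) : UnconditionallyBounded (Sum.elim v w) (K + L) := by
  intro F ε hε
  rw [← Finset.toLeft_disjSum_toRight (u := F), Finset.sum_disjSum]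
  exact (norm_add_le _ _).trans (add_le_add (hv F.toLeft (fun i => ε (Sum.inl i)) fun _ => hε _)
    (hw F.toRight (fun i => ε (Sum.inr i)) fun _ => hε _))

theorem unconditionallyBounded_geometric {Y : Type*} [NormedAddCommGroup Y] [NormedSpace ℝ Y]
    {v : ℕ → Y} (hv : ∀ k, ‖v k‖ ≤ 1) :
    UnconditionallyBounded (fun k => ((1 : ℝ) / 2) ^ k • v k) 2 := by
  intro F ε hε
  refine (norm_sum_le_of_le F (n := fun k => ((1 : ℝ) / 2) ^ k) fun k _ => ?_).trans
    ((summable_geometric_two.sum_le_tsum _ fun _ _ => by positivity).trans tsum_geometric_two.le)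
  rw [norm_smul, norm_smul, Real.norm_eq_abs, norm_pow,
    Real.norm_of_nonneg (by norm_num : (0 : ℝ) ≤ 1 / 2)]
  have h : 0 ≤ ((1 : ℝ) / 2) ^ k := by positivity
  exact (mul_le_of_le_one_left (by positivity) (hε k)).trans (mul_le_of_le_one_right h (hv k))

/-- In an inner product space, some choice of signs makes the norm of a signed sum at least the
`ℓ²`-norm of its terms. -/
theorem exists_signs_sum_norm_sq_le {σ H : Type*} [NormedAddCommGroup H]
    [InnerProductSpace ℝ H] (u : σ → H) (F : Finset σ) :
    ∃ ε : σ → ℝ, (∀ i, |ε i| ≤ 1) ∧ ∑ i ∈ F, ‖u i‖ ^ 2 ≤ ‖∑ i ∈ F, ε i • u i‖ ^ 2 := by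
  classical
  induction F using Finset.induction_on with
  | empty => exact ⟨fun _ => 0, by simp, by simp⟩
  | insert a F ha ih =>
    obtain ⟨ε, hε, h⟩ := ih
    set w := ∑ i ∈ F, ε i • u i with hw
    have key : ∀ c : ℝ, |c| ≤ 1 → ‖u a‖ ^ 2 + ‖w‖ ^ 2 ≤ ‖c • u a + w‖ ^ 2 →
        ∃ ε : σ → ℝ, (∀ i, |ε i| ≤ 1) ∧
          ∑ i ∈ insert a F, ‖u i‖ ^ 2 ≤ ‖∑ i ∈ insert a F, ε i • u i‖ ^ 2 := by
      intro c hc hle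
      refine ⟨Function.update ε a c, fun i => ?_, ?_⟩
      · by_cases hi : i = a
        · subst hi; simpa using hc
        · simpa [hi] using hε i
      · rw [Finset.sum_insert ha, Finset.sum_insert ha]
        have hsum : ∑ i ∈ F, Function.update ε a c i • u i = w :=
          Finset.sum_congr rfl fun i hi => by
            rw [Function.update_of_ne (ne_of_mem_of_not_mem hi ha)]
        rw [hsum, Function.update_self]
        linarith
    have hpar := parallelogram_law_with_norm ℝ (u a) w
    rcases le_total (‖u a - w‖) (‖u a + w‖) with hle | hle
    · refine key 1 (by simp) ?_
      have := norm_nonneg (u a - w)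
      rw [one_smul]
      nlinarith
    · refine key (-1) (by simp) ?_
      have := norm_nonneg (u a + w)
      have hneg : (-1 : ℝ) • u a + w = -(u a - w) := by rw [neg_one_smul]; abel
      rw [hneg, norm_neg]
      nlinarith

theorem UnconditionallyBounded.sum_norm_sq_le {σ H : Type*} [NormedAddCommGroup H]
    [InnerProductSpace ℝ H] {u : σ → H} {K : ℝ} (hu : UnconditionallyBounded u K)
    (F : Finset σ) : ∑ i ∈ F, ‖u i‖ ^ 2 ≤ K ^ 2 := by
  obtain ⟨ε, hε, h⟩ := exists_signs_sum_norm_sq_le u F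
  exact h.trans (pow_le_pow_left₀ (norm_nonneg _) (hu F ε hε) 2)

section BoundedForms

variable {X : Type} [NormedAddCommGroup X] [NormedSpace ℝ X]

/-- The form in `n` variables obtained by applying an element of the bidual to the last variable of
a form in `n + 1` variables. -/
def contractLast {n : ℕ} (e : StrongDual ℝ (StrongDual ℝ X)) :
    ContinuousMultilinearMap ℝ (fun _ : Fin (n + 1) => X) ℝ →ₗ[ℝ]
      ContinuousMultilinearMap ℝ (fun _ : Fin n => X) ℝ where
  toFun Ψ := e.compContinuousMultilinearMap (ContinuousMultilinearMap.curryRight Ψ)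
  map_add' Ψ Φ := by
    ext φ
    have h : (Ψ + Φ).curryRight φ = Ψ.curryRight φ + Φ.curryRight φ := by ext x; simp
    simp [h]
  map_smul' c Ψ := by
    ext φ
    have h : (c • Ψ).curryRight φ = c • Ψ.curryRight φ := by ext x; simp
    simp [h]

theorem contractLast_apply {n : ℕ} (e : StrongDual ℝ (StrongDual ℝ X))
    (Ψ : ContinuousMultilinearMap ℝ (fun _ : Fin (n + 1) => X) ℝ) (φ : Fin n → X) :
    contractLast e Ψ φ = e (ContinuousMultilinearMap.curryRight Ψ φ) := rfl

theorem unconditionallyBounded_contractLast {σ : Type*} {e : σ → StrongDual ℝ (StrongDual ℝ X)}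
    {K : ℝ} (he : UnconditionallyBounded e K) {n : ℕ}
    (Ψ : ContinuousMultilinearMap ℝ (fun _ : Fin (n + 1) => X) ℝ) :
    UnconditionallyBounded (fun i => contractLast (e i) Ψ) (K * ‖Ψ‖) := by
  intro F ε hε
  have h : ∑ i ∈ F, ε i • contractLast (e i) Ψ = contractLast (∑ i ∈ F, ε i • e i) Ψ := by
    ext φ
    simp [contractLast_apply]
  rw [h]
  refine (ContinuousLinearMap.norm_compContinuousMultilinearMap_le _ _).trans ?_
  rw [ContinuousMultilinearMap.curryRight_norm]
  exact mul_le_mul_of_nonneg_right (he F ε hε) (norm_nonneg _)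

/-- If an unconditionally bounded family of the bidual of `X` separates the points of the dual, then
the bounded multilinear forms on `X` embed into a Hilbert space. The embedding for `n + 1` variables
sends a form to the square-summable family of the images of its contractions. -/
theorem exists_injective_to_hilbert {σ : Type} {e : σ → StrongDual ℝ (StrongDual ℝ X)} {K : ℝ}
    (he : UnconditionallyBounded e K)
    (hsep : ∀ χ : StrongDual ℝ X, (∀ i, e i χ = 0) → χ = 0) (n : ℕ) :
    ∃ (H : Type) (_ : NormedAddCommGroup H) (_ : InnerProductSpace ℝ H)
      (J : ContinuousMultilinearMap ℝ (fun _ : Fin n => X) ℝ →L[ℝ] H), Function.Injective J := by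
  induction n with
  | zero =>
    refine ⟨ℝ, inferInstance, inferInstance,
      ContinuousMultilinearMap.apply ℝ (fun _ : Fin 0 => X) ℝ 0, ?_⟩
    intro Ψ Φ h
    ext φ
    rw [Subsingleton.elim φ 0]
    exact h
  | succ n ih =>
    obtain ⟨H, _, _, J, hJ⟩ := ih
    have hK : 0 ≤ K := he.nonneg
    have hsum : ∀ (Ψ : ContinuousMultilinearMap ℝ (fun _ : Fin (n + 1) => X) ℝ) (F : Finset σ),
        ∑ i ∈ F, ‖J (contractLast (e i) Ψ)‖ ^ (2 : ENNReal).toReal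
          ≤ (‖J‖ * K * ‖Ψ‖) ^ (2 : ENNReal).toReal := by
      intro Ψ F
      have := ((unconditionallyBounded_contractLast he Ψ).map J).sum_norm_sq_le F
      simpa [mul_assoc] using this
    let L : ContinuousMultilinearMap ℝ (fun _ : Fin (n + 1) => X) ℝ →ₗ[ℝ]
        lp (fun _ : σ => H) 2 :=
      { toFun := fun Ψ => ⟨fun i => J (contractLast (e i) Ψ), memℓp_gen' (hsum Ψ)⟩
        map_add' := fun Ψ Φ => by
          ext i
          simp only [map_add]
          rfl
        map_smul' := fun c Ψ => by
          ext i
          simp }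
    refine ⟨lp (fun _ : σ => H) 2, inferInstance, inferInstance,
      L.mkContinuous (‖J‖ * K) fun Ψ => ?_, ?_⟩
    · exact lp.norm_le_of_forall_sum_le (by simp) (by positivity) (hsum Ψ)
    · rw [injective_iff_map_eq_zero]
      intro Ψ hΨ
      have h0 : ∀ i, contractLast (e i) Ψ = 0 := by
        intro i
        apply hJ
        rw [map_zero]
        exact congrFun (congrArg (fun f : lp (fun _ : σ => H) 2 => (f : ∀ _ : σ, H)) hΨ) i
      ext φ
      have h1 : ContinuousMultilinearMap.curryRight Ψ (Fin.init φ) = 0 :=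
        hsep _ fun i => by rw [← contractLast_apply, h0]; rfl
      have h2 := DFunLike.congr_fun h1 (φ (Fin.last n))
      rw [ContinuousMultilinearMap.curryRight_apply] at h2
      simpa using h2

/-- Only countably many members of an unconditionally bounded separating family of the bidual act
nontrivially on a given variable of a bounded multilinear form. -/
theorem countable_setOf_bidual_ne_zero {σ : Type} {e : σ → StrongDual ℝ (StrongDual ℝ X)}
    {K : ℝ} (he : UnconditionallyBounded e K)
    (hsep : ∀ χ : StrongDual ℝ X, (∀ i, e i χ = 0) → χ = 0)
    {ι : Type*} [Fintype ι] [DecidableEq ι] (Ψ : ContinuousMultilinearMap ℝ (fun _ : ι => X) ℝ)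
    (k : ι) : {i | ∃ φ : ι → X, e i (Ψ.toContinuousLinearMap φ k) ≠ 0}.Countable := by
  obtain ⟨n, hn⟩ : ∃ n, Fintype.card ι = n + 1 :=
    Nat.exists_eq_succ_of_ne_zero (Fintype.card_pos_iff.mpr ⟨k⟩).ne'
  obtain ⟨g, hg⟩ : ∃ g : ι ≃ Fin (n + 1), g k = Fin.last n := by
    let g₀ := Fintype.equivFinOfCardEq hn
    exact ⟨g₀.trans (Equiv.swap (g₀ k) (Fin.last n)), by simp⟩
  let Ψ' : ContinuousMultilinearMap ℝ (fun _ : Fin (n + 1) => X) ℝ :=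
    ContinuousMultilinearMap.domDomCongr g Ψ
  obtain ⟨H, _, _, J, hJ⟩ := exists_injective_to_hilbert he hsep n
  have hsum := summable_of_sum_le (fun _ => by positivity)
    ((unconditionallyBounded_contractLast he Ψ').map J).sum_norm_sq_le
  refine hsum.countable_support.mono ?_
  rintro i ⟨φ, hφ⟩ h0
  have h1 : contractLast (e i) Ψ' = 0 := hJ (by simpa using h0)
  apply hφ
  have h2 : Ψ.toContinuousLinearMap φ k =
      ContinuousMultilinearMap.curryRight Ψ' (fun j => φ (g.symm j.castSucc)) := by
    ext x
    rw [ContinuousMultilinearMap.curryRight_apply]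
    change Ψ (Function.update φ k x) = Ψ _
    congr 1
    ext j
    rcases Fin.eq_castSucc_or_eq_last (g j) with ⟨r, hr⟩ | hr
    · have hj : j ≠ k := fun h => (Fin.castSucc_lt_last r).ne (by rw [← hr, h, hg])
      rw [Function.update_of_ne hj]
      simp only [hr, Fin.snoc_castSucc]
      rw [← hr, Equiv.symm_apply_apply]
    · have hj : j = k := g.injective (hr.trans hg.symm)
      subst hj
      simp [hr]
  rw [h2, ← contractLast_apply, h1]
  rfl

end BoundedForms

/-! ### Rounding down to a finite set -/

/-- The largest element of `P` below `s`; it is `0` if there is none. -/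
def floor (P : Finset unitInterval) (s : unitInterval) : unitInterval :=
  (P.filter (· ≤ s)).sup id

theorem floor_le (P : Finset unitInterval) (s : unitInterval) : floor P s ≤ s :=
  Finset.sup_le fun _ hp => (Finset.mem_filter.mp hp).2

theorem le_floor {P : Finset unitInterval} {p s : unitInterval} (hp : p ∈ P) (h : p ≤ s) :
    p ≤ floor P s :=
  Finset.le_sup (f := id) (Finset.mem_filter.mpr ⟨hp, h⟩)

theorem floor_mem {P : Finset unitInterval} (h0 : 0 ∈ P) (s : unitInterval) : floor P s ∈ P := by
  obtain ⟨p, hp, h⟩ := Finset.exists_mem_eq_sup (P.filter (· ≤ s))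
    ⟨0, Finset.mem_filter.mpr ⟨h0, unitInterval.nonneg'⟩⟩ id
  rw [floor, h]
  exact (Finset.mem_filter.mp hp).1

theorem floor_lt_iff {P : Finset unitInterval} {p s : unitInterval} (hp : p ∈ P) :
    floor P s < p ↔ s < p :=
  ⟨fun h => lt_of_not_ge fun h' => (le_floor hp h').not_gt h, (floor_le P s).trans_lt⟩

theorem floor_eq_iff {P : Finset unitInterval} {p s : unitInterval} (hp : p ∈ P) :
    floor P s = p ↔ p ≤ s ∧ ∀ q ∈ P, p < q → s < q := by
  constructor
  · rintro rfl
    exact ⟨floor_le P s, fun q hq h => (floor_lt_iff hq).mp h⟩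
  · rintro ⟨h1, h2⟩
    refine le_antisymm (Finset.sup_le fun q hq => ?_) (le_floor hp h1)
    rw [Finset.mem_filter] at hq
    exact le_of_not_gt fun h => (h2 q hq.1 h).not_ge hq.2

/-- The half-line `[0, a)` if `left` holds, and `[a, 1]` otherwise. -/
def halfLine (left : Prop) (a : unitInterval) : Set unitInterval :=
  {s | (left → s < a) ∧ (¬ left → a ≤ s)}

theorem halfLine_of {left : Prop} (h : left) (a : unitInterval) : halfLine left a = Iio a := by
  ext s; simp [halfLine, h]

theorem halfLine_of_not {left : Prop} (h : ¬ left) (a : unitInterval) :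
    halfLine left a = Ici a := by
  ext s; simp [halfLine, h]

theorem eventually_floor_eq (P : Finset unitInterval) (left : Prop) (t : unitInterval) :
    ∃ c, ∀ᶠ s in 𝓝[halfLine left t] t, floor P s = c := by
  have hlt : ∀ᶠ s in 𝓝 t, ∀ p ∈ P, p < t → p ≤ s := by
    refine (Finset.eventually_all P).mpr fun p _ => ?_
    by_cases hp : p < t
    · exact (lt_mem_nhds hp).mono fun s hs _ => hs.le
    · exact Eventually.of_forall fun s h => absurd h hp
  have hgt : ∀ᶠ s in 𝓝 t, ∀ p ∈ P, t < p → s < p := by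
    refine (Finset.eventually_all P).mpr fun p _ => ?_
    by_cases hp : t < p
    · exact (gt_mem_nhds hp).mono fun s hs _ => hs
    · exact Eventually.of_forall fun s h => absurd h hp
  by_cases hl : left
  · refine ⟨(P.filter (· < t)).sup id, ?_⟩
    rw [halfLine_of hl]
    filter_upwards [mem_nhdsWithin_of_mem_nhds hlt, self_mem_nhdsWithin] with s hs hst
    refine congrArg (fun Q : Finset unitInterval => Q.sup id) (Finset.filter_congr fun p hp => ?_)
    exact ⟨fun h => h.trans_lt hst, hs p hp⟩
  · refine ⟨floor P t, ?_⟩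
    rw [halfLine_of_not hl]
    filter_upwards [mem_nhdsWithin_of_mem_nhds hgt, self_mem_nhdsWithin] with s hs hst
    refine congrArg (fun Q : Finset unitInterval => Q.sup id) (Finset.filter_congr fun p hp => ?_)
    exact ⟨fun h => le_of_not_gt fun h' => (hs p hp h').not_ge h, fun h => h.trans hst⟩

/-- Rounding down to `P` for `some P`, and no rounding for `none`. -/
def rounding : Option (Finset unitInterval) → unitInterval → unitInterval
  | none => id
  | some P => floor P

theorem tendsto_rounding (o : Option (Finset unitInterval)) (left : Prop) (t : unitInterval) :
    ∃ (c : unitInterval) (left' : Prop),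
      Tendsto (rounding o) (𝓝[halfLine left t] t) (𝓝[halfLine left' c] c) := by
  cases o with
  | none => exact ⟨t, left, tendsto_id⟩
  | some P =>
    obtain ⟨c, hc⟩ := eventually_floor_eq P left t
    refine ⟨c, False, (tendsto_pure.mpr hc).mono_right ?_⟩
    rw [halfLine_of_not id]
    exact pure_le_nhdsWithin self_mem_Ici

/-- A neighbourhood `V` of `t` contains the roundings of all points of a smaller neighbourhood as
soon as the rounding set contains finitely many suitable points: `t` itself and, if `t ≠ 0`, some
`a < t` in `V`. -/
theorem exists_floor_mem {t : unitInterval} {V : Set unitInterval} (hV : V ∈ 𝓝 t) :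
    ∃ W ∈ 𝓝 t, ∃ P : Finset unitInterval, t ∈ P ∧ W ⊆ V ∧
      ∀ P' : Finset unitInterval, P ⊆ P' → ∀ s ∈ W, floor P' s ∈ V := by
  obtain ⟨δ, hδ, hball⟩ := Metric.mem_nhds_iff.mp hV
  have hord : (Metric.ball t δ).OrdConnected := by
    refine ⟨fun a ha b hb c hc => ?_⟩
    rw [Metric.mem_ball, Subtype.dist_eq, Real.dist_eq, abs_lt] at ha hb ⊢
    have h1 : (a : ℝ) ≤ c := hc.1
    have h2 : (c : ℝ) ≤ b := hc.2
    constructor <;> linarith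
  obtain ⟨a, ha, hat⟩ : ∃ a ∈ Metric.ball t δ, Ici a ∈ 𝓝 t := by
    rcases eq_or_ne t 0 with rfl | ht
    · exact ⟨0, Metric.mem_ball_self hδ, univ_mem' fun s => unitInterval.nonneg'⟩
    · have hne : (𝓝[<] t).NeBot :=
        nhdsLT_neBot_of_exists_lt ⟨0, lt_of_le_of_ne unitInterval.nonneg' ht.symm⟩
      obtain ⟨a, ha, hlt⟩ := hne.nonempty_of_mem
        (inter_mem (mem_nhdsWithin_of_mem_nhds (Metric.ball_mem_nhds t hδ)) self_mem_nhdsWithin)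
      exact ⟨a, ha, Ici_mem_nhds hlt⟩
  refine ⟨Metric.ball t δ ∩ Ici a, inter_mem (Metric.ball_mem_nhds t hδ) hat, {a, t}, by simp,
    inter_subset_left.trans hball, fun P' hP' s hs => hball ?_⟩
  exact hord.out ha hs.1 ⟨le_floor (hP' (by simp)) hs.2, floor_le P' s⟩

variable {m : ℕ}

theorem nhdsWithin_octant (t : Cube m) (J : Finset (Fin m)) :
    𝓝[octant t J] t = Filter.pi fun i => 𝓝[halfLine (i ∈ J) (t i)] t i := by
  have h : octant t J = univ.pi fun i => halfLine (i ∈ J) (t i) := by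
    ext s
    simp [octant, halfLine]
  rw [h, nhdsWithin_pi_univ_eq]
  rfl

/-- The limits of a function in `D([0,1]^m)`. If an interval `[0, t i)` is empty, the filter is
trivial, so the condition `0 < t i` of the definition is not needed. -/
theorem IsCadlag.exists_tendsto {f : Cube m → ℝ} (hf : IsCadlag f) (t : Cube m)
    (left : Fin m → Prop) :
    ∃ l : ℝ, Tendsto f (Filter.pi fun i => 𝓝[halfLine (left i) (t i)] t i) (𝓝 l) := by
  classical
  have hoct := nhdsWithin_octant t (Finset.univ.filter left)
  simp only [Finset.mem_filter, Finset.mem_univ, true_and] at hoct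
  rw [← hoct]
  by_cases h : ∀ i ∈ Finset.univ.filter left, 0 < t i
  · exact hf t _ h
  · push Not at h
    obtain ⟨i, hi, hti⟩ := h
    have hempty : octant t (Finset.univ.filter left) = ∅ := by
      ext s
      simp only [mem_empty_iff_false, iff_false]
      intro hs
      exact (((hs i).1 hi).trans_le hti).not_ge unitInterval.nonneg'
    exact ⟨0, by simp [hempty]⟩

theorem isCadlag_of_tendsto {f : Cube m → ℝ} (h : ∀ (t : Cube m) (left : Fin m → Prop),
    ∃ l : ℝ, Tendsto f (Filter.pi fun i => 𝓝[halfLine (left i) (t i)] t i) (𝓝 l)) :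
    IsCadlag f := by
  intro t J _
  rw [nhdsWithin_octant]
  exact h t (· ∈ J)

theorem IsCadlag.comp_rounding {f : Cube m → ℝ} (hf : IsCadlag f)
    (r : Fin m → Option (Finset unitInterval)) :
    IsCadlag fun s => f fun i => rounding (r i) (s i) := by
  refine isCadlag_of_tendsto fun t left => ?_
  choose c left' h using fun i => tendsto_rounding (r i) (left i) (t i)
  obtain ⟨l, hl⟩ := hf.exists_tendsto c left'
  refine ⟨l, hl.comp ?_⟩
  exact tendsto_pi.mpr fun i => (h i).comp (tendsto_eval_pi _ i)

/-- The operator that replaces a function by its values at the rounded points; the `i`-th coordinate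
is rounded down to `P` if `r i = some P` and left alone if `r i = none`. -/
def sample (r : Fin m → Option (Finset unitInterval)) : D m →ₗ[ℝ] D m where
  toFun f := D.mk (fun s => f fun i => rounding (r i) (s i)) (f.isCadlag.comp_rounding r)
  map_add' _ _ := rfl
  map_smul' _ _ := rfl

theorem sample_apply (r : Fin m → Option (Finset unitInterval)) (f : D m) (s : Cube m) :
    sample r f s = f fun i => rounding (r i) (s i) := rfl

theorem norm_sample_le (r : Fin m → Option (Finset unitInterval)) (f : D m) :
    ‖sample r f‖ ≤ ‖f‖ :=
  D.norm_le fun _ => D.abs_apply_le_norm f _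

/-- Functions in `D([0,1]^m)` are uniformly approximated by their values on suitable finite
grids. -/
theorem exists_norm_sample_sub_le (f : D m) {ε : ℝ} (hε : 0 < ε) :
    ∃ P : Finset unitInterval, 0 ∈ P ∧ ‖sample (fun _ => some P) f - f‖ ≤ ε := by
  classical
  have key : ∃ P : Finset unitInterval, ∀ P' : Finset unitInterval, P ⊆ P' →
      ∀ s ∈ (univ : Set (Cube m)), |f (fun i => floor P' (s i)) - f s| ≤ ε := by
    refine isCompact_univ.induction_on (p := fun S => ∃ P : Finset unitInterval,
      ∀ P' : Finset unitInterval, P ⊆ P' → ∀ s ∈ S, |f (fun i => floor P' (s i)) - f s| ≤ ε)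
      ⟨∅, by simp⟩ ?_ ?_ ?_
    · rintro S T hST ⟨P, hP⟩
      exact ⟨P, fun P' h s hs => hP P' h s (hST hs)⟩
    · rintro S T ⟨P, hP⟩ ⟨Q, hQ⟩
      refine ⟨P ∪ Q, fun P' h s hs => ?_⟩
      rcases hs with hs | hs
      · exact hP P' (Finset.union_subset_left h) s hs
      · exact hQ P' (Finset.union_subset_right h) s hs
    · intro t _
      have h1 : ∀ J : Finset (Fin m), ∃ l : ℝ, ∀ᶠ s in 𝓝 t, s ∈ octant t J → |f s - l| < ε / 2 := by
        intro J
        obtain ⟨l, hl⟩ := f.isCadlag.exists_tendsto t (· ∈ J)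
        rw [← nhdsWithin_octant] at hl
        exact ⟨l, eventually_nhdsWithin_iff.mp
          (hl.eventually (Metric.ball_mem_nhds l (half_pos hε)))⟩
      choose l hl using h1
      have hU := eventually_all.mpr hl
      rw [nhds_pi, Filter.eventually_iff, Filter.mem_pi'] at hU
      obtain ⟨A, V, hV, hVU⟩ := hU
      choose W hW P htP hWV hP using fun i => exists_floor_mem (hV i)
      refine ⟨univ.pi W, mem_nhdsWithin_of_mem_nhds (set_pi_mem_nhds finite_univ fun i _ => hW i),
        Finset.univ.biUnion P, fun P' hP' s hs => ?_⟩
      have hPP' : ∀ i, P i ⊆ P' := fun i =>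
        (Finset.subset_biUnion_of_mem P (Finset.mem_univ i)).trans hP'
      set J := Finset.univ.filter fun i => s i < t i with hJ
      have hsJ : s ∈ octant t J := fun i => by simp [hJ]
      -- rounding does not change the octant, since the coordinates of `t` are grid points
      have hfJ : (fun i => floor P' (s i)) ∈ octant t J := fun i => by
        have := floor_lt_iff (s := s i) (hPP' i (htP i))
        simp only [hJ, Finset.mem_filter, Finset.mem_univ, true_and, ← this, not_lt]
        exact ⟨id, id⟩
      have e1 := hVU (fun i _ => hWV i (hs i (mem_univ i))) J hsJ
      have e2 := hVU (fun i _ => hP i P' (hPP' i) (s i) (hs i (mem_univ i))) J hfJ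
      rw [abs_lt] at e1 e2
      rw [abs_le]
      constructor <;> linarith [e1.1, e1.2, e2.1, e2.2]
  obtain ⟨P, hP⟩ := key
  refine ⟨insert 0 P, Finset.mem_insert_self _ _, D.norm_le fun s => ?_⟩
  rw [sub_eq_add_neg, D.add_apply, D.neg_apply, ← sub_eq_add_neg]
  exact hP _ (Finset.subset_insert _ _) s (mem_univ s)

/-! ### Tensor products of functions of one variable -/

theorem isCadlag_prod (φ : Fin m → D 1) : IsCadlag fun t : Cube m => ∏ i, φ i fun _ => t i := by
  refine isCadlag_of_tendsto fun t left => ?_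
  choose l hl using fun i => (φ i).isCadlag.exists_tendsto (fun _ => t i) (fun _ => left i)
  refine ⟨∏ i, l i, tendsto_finsetProd _ fun i _ => (hl i).comp ?_⟩
  exact tendsto_pi.mpr fun _ => tendsto_eval_pi _ i

/-- The tensor product `t ↦ φ₁(t₁) ⋯ φ_m(t_m)`. -/
def tensor (m : ℕ) : MultilinearMap ℝ (fun _ : Fin m => D 1) (D m) where
  toFun φ := D.mk (fun t => ∏ i, φ i fun _ => t i) (isCadlag_prod φ)
  map_update_add' φ i x y := by
    ext t
    simp only [D.mk_apply, D.add_apply]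
    rw [← Finset.mul_prod_erase _ _ (Finset.mem_univ i), ← Finset.mul_prod_erase _ _
      (Finset.mem_univ i), ← Finset.mul_prod_erase _ _ (Finset.mem_univ i)]
    simp only [Function.update_self, D.add_apply, add_mul]
    congr 2 <;> refine Finset.prod_congr rfl fun j hj => ?_ <;>
      rw [Function.update_of_ne (Finset.ne_of_mem_erase hj),
        Function.update_of_ne (Finset.ne_of_mem_erase hj)]
  map_update_smul' φ i c x := by
    ext t
    simp only [D.mk_apply, D.smul_apply]
    rw [← Finset.mul_prod_erase _ _ (Finset.mem_univ i), ← Finset.mul_prod_erase _ _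
      (Finset.mem_univ i)]
    simp only [Function.update_self, D.smul_apply, mul_assoc]
    congr 2
    refine Finset.prod_congr rfl fun j hj => ?_
    rw [Function.update_of_ne (Finset.ne_of_mem_erase hj),
      Function.update_of_ne (Finset.ne_of_mem_erase hj)]

theorem tensor_apply (φ : Fin m → D 1) (t : Cube m) : tensor m φ t = ∏ i, φ i fun _ => t i := rfl

theorem norm_tensor_le (φ : Fin m → D 1) : ‖tensor m φ‖ ≤ ∏ i, ‖φ i‖ := by
  refine D.norm_le fun t => ?_
  rw [tensor_apply, Finset.abs_prod]
  exact Finset.prod_le_prod (fun _ _ => abs_nonneg _) fun i _ => D.abs_apply_le_norm _ _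

theorem sample_tensor (r : Fin m → Option (Finset unitInterval)) (φ : Fin m → D 1) :
    sample r (tensor m φ) = tensor m fun i => sample (fun _ => r i) (φ i) := rfl

/-- The indicator function of `[a, 1]`. -/
def step (a : unitInterval) : D 1 :=
  D.mk (fun t => if a ≤ t 0 then 1 else 0) <| isCadlag_of_tendsto fun t left => by
    suffices h : ∃ c : ℝ, ∀ᶠ s in 𝓝[halfLine (left 0) (t 0)] t 0,
        (if a ≤ s then (1 : ℝ) else 0) = c by
      obtain ⟨c, hc⟩ := h
      refine ⟨c, Tendsto.congr' ?_ tendsto_const_nhds⟩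
      filter_upwards [(tendsto_eval_pi (fun i => 𝓝[halfLine (left i) (t i)] t i) 0).eventually hc]
        with s hs
      exact hs.symm
    by_cases hl : left 0
    · rw [halfLine_of hl]
      rcases lt_or_ge a (t 0) with h | h
      · exact ⟨1, mem_nhdsWithin_of_mem_nhds ((lt_mem_nhds h).mono fun s hs => if_pos hs.le)⟩
      · refine ⟨0, ?_⟩
        filter_upwards [self_mem_nhdsWithin] with s hs
        exact if_neg (not_le.mpr (lt_of_lt_of_le hs h))
    · rw [halfLine_of_not hl]
      rcases le_or_gt a (t 0) with h | h
      · refine ⟨1, ?_⟩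
        filter_upwards [self_mem_nhdsWithin] with s hs
        exact if_pos (h.trans hs)
      · exact ⟨0, mem_nhdsWithin_of_mem_nhds
          ((gt_mem_nhds h).mono fun s hs => if_neg (not_le.mpr hs))⟩

theorem step_apply (a : unitInterval) (t : Cube 1) : step a t = if a ≤ t 0 then 1 else 0 := rfl

/-- The indicator function of a cell of the partition with left end points `P` is a step function:
the cell of `p` is `[p, q)` with `q` the next point of `P`, or `[p, 1]` if there is none. -/
theorem exists_cell_mem_span_step {P : Finset unitInterval} {p : unitInterval} (hp : p ∈ P) :
    ∃ b ∈ Submodule.span ℝ (range step), ∀ t : Cube 1, b t = if floor P (t 0) = p then 1 else 0 := by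
  have hstep : ∀ a, step a ∈ Submodule.span ℝ (range step) :=
    fun a => Submodule.subset_span (mem_range_self a)
  by_cases hne : (P.filter (p < ·)).Nonempty
  · obtain ⟨hqP, hpq⟩ := Finset.mem_filter.mp (Finset.min'_mem _ hne)
    set q := (P.filter (p < ·)).min' hne with hq
    refine ⟨step p - step q, Submodule.sub_mem _ (hstep p) (hstep q), fun t => ?_⟩
    have h : floor P (t 0) = p ↔ p ≤ t 0 ∧ t 0 < q := by
      rw [floor_eq_iff hp]
      refine and_congr_right fun _ => ⟨fun h => h q hqP hpq, fun h r hr hpr => ?_⟩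
      exact h.trans_le (Finset.min'_le _ _ (Finset.mem_filter.mpr ⟨hr, hpr⟩))
    rw [sub_eq_add_neg, D.add_apply, D.neg_apply, step_apply, step_apply]
    simp only [h]
    rcases lt_or_ge (t 0) q with h1 | h1
    · simp [h1, not_le.mpr h1]
    · simp [hpq.le.trans h1, h1, not_lt.mpr h1]
  · refine ⟨step p, hstep p, fun t => ?_⟩
    have h : floor P (t 0) = p ↔ p ≤ t 0 := by
      rw [floor_eq_iff hp]
      refine and_iff_left fun q hq hpq => absurd ⟨q, Finset.mem_filter.mpr ⟨hq, hpq⟩⟩ hne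
    simp only [step_apply, h]

/-- The values on a grid depend linearly on finitely many point evaluations. -/
theorem exists_sample_eq_sum (P : Fin m → Finset unitInterval) (h0 : ∀ i, 0 ∈ P i) :
    ∃ b : Cube m → Fin m → D 1,
      (∀ p ∈ Fintype.piFinset P, ∀ i, b p i ∈ Submodule.span ℝ (range step)) ∧
      ∀ f : D m, sample (fun i => some (P i)) f =
        ∑ p ∈ Fintype.piFinset P, f p • tensor m (b p) := by
  have hex : ∀ (p : Cube m) (i : Fin m), ∃ b : D 1, p i ∈ P i →
      b ∈ Submodule.span ℝ (range step) ∧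
        ∀ t : Cube 1, b t = if floor (P i) (t 0) = p i then 1 else 0 := by
    intro p i
    by_cases hp : p i ∈ P i
    · obtain ⟨b, hb⟩ := exists_cell_mem_span_step hp
      exact ⟨b, fun _ => hb⟩
    · exact ⟨0, fun h => absurd h hp⟩
  choose b hb using hex
  refine ⟨b, fun p hp i => (hb p i (Fintype.mem_piFinset.mp hp i)).1, fun f => ?_⟩
  · ext s
    let E : D m →+ ℝ := ⟨⟨fun g => g s, rfl⟩, fun _ _ => rfl⟩
    have hE : ∀ g : D m, g s = E g := fun _ => rfl
    rw [hE (∑ p ∈ _, _), map_sum, Finset.sum_eq_single fun i => floor (P i) (s i)]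
    · rw [← hE, D.smul_apply, tensor_apply, Finset.prod_eq_one, mul_one]
      · rfl
      · intro i _
        rw [(hb _ i (floor_mem (h0 i) _)).2]
        simp
    · intro p hp hne
      obtain ⟨i, hi⟩ := Function.ne_iff.mp hne
      rw [← hE, D.smul_apply, tensor_apply, Finset.prod_eq_zero (Finset.mem_univ i), mul_zero]
      rw [(hb p i (Fintype.mem_piFinset.mp hp i)).2]
      simpa using fun h => hi h.symm
    · intro h
      exact absurd (Fintype.mem_piFinset.mpr fun i => floor_mem (h0 i) _) h

/-! ### Density of step functions and of tensor products -/

theorem dense_span_range_tensor (m : ℕ) :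
    Dense (Submodule.span ℝ (range (tensor m)) : Set (D m)) := by
  intro f
  refine Metric.mem_closure_iff.mpr fun ε hε => ?_
  obtain ⟨P, h0, hP⟩ := exists_norm_sample_sub_le f (half_pos hε)
  obtain ⟨b, -, hb⟩ := exists_sample_eq_sum (fun _ : Fin m => P) fun _ => h0
  refine ⟨sample (fun _ => some P) f, ?_, ?_⟩
  · rw [hb f]
    exact Submodule.sum_mem _ fun p _ =>
      Submodule.smul_mem _ _ (Submodule.subset_span (mem_range_self _))
  · rw [dist_comm, dist_eq_norm]
    exact lt_of_le_of_lt hP (half_lt_self hε)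

theorem dense_span_range_step : Dense (Submodule.span ℝ (range step) : Set (D 1)) := by
  intro f
  refine Metric.mem_closure_iff.mpr fun ε hε => ?_
  obtain ⟨P, h0, hP⟩ := exists_norm_sample_sub_le f (half_pos hε)
  obtain ⟨b, hmem, hb⟩ := exists_sample_eq_sum (fun _ : Fin 1 => P) fun _ => h0
  refine ⟨sample (fun _ => some P) f, ?_, ?_⟩
  · rw [hb f]
    refine Submodule.sum_mem _ fun p hp => Submodule.smul_mem _ _ ?_
    have h : tensor 1 (b p) = b p 0 := by
      ext t
      rw [tensor_apply, Fin.prod_univ_one]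
      congr 1
      ext i
      rw [Subsingleton.elim i 0]
    rw [h]
    exact hmem p hp 0
  · rw [dist_comm, dist_eq_norm]
    exact lt_of_le_of_lt hP (half_lt_self hε)

/-- Convergence to zero of uniformly bounded linear functionals may be tested on a set with dense
span. -/
theorem tendsto_zero_of_dense_span {E : Type*} [NormedAddCommGroup E] [NormedSpace ℝ E]
    {S : Set E} (hS : Dense (Submodule.span ℝ S : Set E)) {lam : ℕ → E →ₗ[ℝ] ℝ} {C : ℝ}
    (hC : ∀ n x, |lam n x| ≤ C * ‖x‖) (h : ∀ x ∈ S, Tendsto (fun n => lam n x) atTop (𝓝 0))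
    (x : E) : Tendsto (fun n => lam n x) atTop (𝓝 0) := by
  have hspan : ∀ y ∈ Submodule.span ℝ S, Tendsto (fun n => lam n y) atTop (𝓝 0) := by
    intro y hy
    induction hy using Submodule.span_induction with
    | mem y hy => exact h y hy
    | zero => simp
    | add y z _ _ hy hz => simpa using hy.add hz
    | smul c y _ hy => simpa using hy.const_mul c
  rw [Metric.tendsto_atTop]
  intro ε hε
  have hC1 : 0 < |C| + 1 := by positivity
  obtain ⟨y, hy, hxy⟩ := Metric.mem_closure_iff.mp (hS x) (ε / 2 / (|C| + 1)) (by positivity)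
  obtain ⟨N, hN⟩ := Metric.tendsto_atTop.mp (hspan y hy) (ε / 2) (half_pos hε)
  refine ⟨N, fun n hn => ?_⟩
  have h1 := hN n hn
  rw [Real.dist_eq, sub_zero] at h1 ⊢
  have h2 : |lam n (x - y)| < ε / 2 := by
    rw [dist_eq_norm, lt_div_iff₀ hC1] at hxy
    have h3 := hC n (x - y)
    have h4 := mul_le_mul_of_nonneg_right (le_abs_self C) (norm_nonneg (x - y))
    have h5 := norm_nonneg (x - y)
    linarith
  have h6 : lam n x = lam n (x - y) + lam n y := by rw [← map_add, sub_add_cancel]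
  rw [h6]
  exact (abs_add_le _ _).trans_lt (by linarith)

/-- Convergence to zero of uniformly bounded multilinear forms may be tested on arguments from a set
with dense span; the arguments are freed one at a time. -/
theorem tendsto_zero_multilinear_of_dense_span {E : Type*} [NormedAddCommGroup E]
    [NormedSpace ℝ E] {S : Set E} (hS : Dense (Submodule.span ℝ S : Set E)) {ι : Type*} [Fintype ι]
    {Φ : ℕ → MultilinearMap ℝ (fun _ : ι => E) ℝ} {C : ℝ}
    (hC : ∀ n f, |Φ n f| ≤ C * ∏ j, ‖f j‖)
    (h : ∀ f : ι → E, (∀ j, f j ∈ S) → Tendsto (fun n => Φ n f) atTop (𝓝 0))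
    (f : ι → E) : Tendsto (fun n => Φ n f) atTop (𝓝 0) := by
  classical
  -- the arguments in `A` are arbitrary, the others are still restricted to `S`
  suffices H : ∀ (A : Finset ι) (f : ι → E), (∀ j ∉ A, f j ∈ S) →
      Tendsto (fun n => Φ n f) atTop (𝓝 0) from H Finset.univ f (by simp)
  intro A
  induction A using Finset.induction_on with
  | empty => exact fun f hf => h f fun j => hf j (by simp)
  | insert a A _ ih =>
    intro f hf
    have := tendsto_zero_of_dense_span hS (lam := fun n => (Φ n).toLinearMap f a)
      (C := C * ∏ j ∈ Finset.univ.erase a, ‖f j‖) (fun n x => ?_) (fun x hx => ?_) (f a)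
    · simpa using this
    · refine (hC n _).trans (le_of_eq ?_)
      rw [← Finset.mul_prod_erase _ _ (Finset.mem_univ a), Function.update_self]
      rw [Finset.prod_congr rfl fun j hj => by
        rw [Function.update_of_ne (Finset.ne_of_mem_erase hj)]]
      ring
    · refine ih _ fun j hj => ?_
      by_cases hja : j = a
      · subst hja; simpa using hx
      · rw [Function.update_of_ne hja]
        exact hf j (by simp [hja, hj])

/-! ### Atoms of functionals on the càdlàg functions of one variable -/

theorem step_sub_step_apply {a b : unitInterval} (hab : a ≤ b) (t : Cube 1) :
    (step a - step b) t = if a ≤ t 0 ∧ t 0 < b then 1 else 0 := by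
  rw [sub_eq_add_neg, D.add_apply, D.neg_apply, step_apply, step_apply]
  rcases lt_or_ge (t 0) b with h | h
  · simp [h, not_le.mpr h]
  · simp [h, hab.trans h, not_lt.mpr h]

/-- The indicator functions of disjoint intervals `[a i, b i)` are unconditionally bounded. -/
theorem norm_sum_step_sub_step_le {σ : Type*} (F : Finset σ) {a b : σ → unitInterval}
    (hab : ∀ i ∈ F, a i ≤ b i)
    (hdisj : ∀ i ∈ F, ∀ j ∈ F, i ≠ j → b i ≤ a j ∨ b j ≤ a i)
    {ε : σ → ℝ} (hε : ∀ i, |ε i| ≤ 1) :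
    ‖∑ i ∈ F, ε i • (step (a i) - step (b i))‖ ≤ 1 := by
  refine D.norm_le fun t => ?_
  let E : D 1 →+ ℝ := ⟨⟨fun g => g t, rfl⟩, fun _ _ => rfl⟩
  have hE : (∑ i ∈ F, ε i • (step (a i) - step (b i))) t =
      ∑ i ∈ F, ε i * if a i ≤ t 0 ∧ t 0 < b i then 1 else 0 := by
    refine (map_sum E _ F).trans (Finset.sum_congr rfl fun i hi => ?_)
    rw [← step_sub_step_apply (hab i hi)]
    rfl
  rw [hE]
  by_cases h : ∃ i ∈ F, a i ≤ t 0 ∧ t 0 < b i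
  · obtain ⟨i, hi, hit⟩ := h
    rw [Finset.sum_eq_single_of_mem i hi, if_pos hit, mul_one]
    · exact hε i
    · intro j hj hji
      rw [if_neg, mul_zero]
      rintro ⟨h1, h2⟩
      rcases hdisj i hi j hj hji.symm with h3 | h3
      · exact (hit.2.trans_le (h3.trans h1)).false
      · exact (h2.trans_le (h3.trans hit.1)).false
  · rw [Finset.sum_eq_zero, abs_zero]
    · exact zero_le_one
    · intro i hi
      rw [if_neg fun hit => h ⟨i, hi, hit⟩, mul_zero]

/-- The variation over a partition is the value of `χ` at a signed sum of indicator functions of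
disjoint intervals. -/
theorem boundedVariationOn_step (χ : StrongDual ℝ (D 1)) (a : unitInterval) :
    BoundedVariationOn (fun b => χ (step a - step b)) univ := by
  refine ne_top_of_le_ne_top (b := ENNReal.ofReal ‖χ‖) ENNReal.ofReal_ne_top ?_
  refine iSup_le ?_
  rintro ⟨n, u, hu, -⟩
  have hterm : ∀ i, edist (χ (step a - step (u (i + 1)))) (χ (step a - step (u i))) =
      ENNReal.ofReal |χ (step (u i) - step (u (i + 1)))| := fun i => by
    rw [edist_dist, Real.dist_eq, ← map_sub, sub_sub_sub_cancel_left]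
  simp only [hterm]
  rw [← ENNReal.ofReal_sum_of_nonneg fun _ _ => abs_nonneg _]
  refine ENNReal.ofReal_le_ofReal ?_
  set ε : ℕ → ℝ := fun i => SignType.sign (χ (step (u i) - step (u (i + 1)))) with hε
  have hε1 : ∀ i, |ε i| ≤ 1 := fun i => by
    simp only [hε]
    rcases SignType.sign (χ (step (u i) - step (u (i + 1)))) with _ | _ | _ <;> simp
  have hsum : ∑ i ∈ Finset.range n, |χ (step (u i) - step (u (i + 1)))| =
      χ (∑ i ∈ Finset.range n, ε i • (step (u i) - step (u (i + 1)))) := by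
    rw [map_sum]
    refine Finset.sum_congr rfl fun i _ => ?_
    rw [map_smul, smul_eq_mul, sign_mul_self]
  rw [hsum]
  refine (le_abs_self _).trans ((χ.le_opNorm _).trans ?_)
  refine mul_le_of_le_one_right (norm_nonneg _) (norm_sum_step_sub_step_le _
    (fun i _ => hu (Nat.le_succ i)) (fun i _ j _ hij => ?_) hε1)
  rcases lt_or_gt_of_ne hij with h | h
  · exact Or.inl (hu h)
  · exact Or.inr (hu h)

/-- The right limits in the definition of `jump` are limits along a sequence that does not depend on
the functional. -/
theorem exists_seq_tendsto_jump (a : unitInterval) :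
    ∃ u : ℕ → unitInterval, (∀ n, a ≤ u n) ∧ Tendsto u atTop (𝓝 a) ∧
      ∀ χ : StrongDual ℝ (D 1), Tendsto (fun n => χ (step a - step (u n))) atTop
        (𝓝 (Function.rightLim (fun b => χ (step a - step b)) a)) := by
  rcases eq_or_ne a 1 with rfl | ha
  · refine ⟨fun _ => 1, fun _ => le_rfl, tendsto_const_nhds, fun χ => ?_⟩
    rw [rightLim_eq_of_isTop fun _ => unitInterval.le_one']
    exact tendsto_const_nhds
  · have hne : (𝓝[>] a).NeBot :=
      nhdsGT_neBot_of_exists_gt ⟨1, lt_of_le_of_ne unitInterval.le_one' ha⟩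
    obtain ⟨u, hu⟩ := exists_seq_tendsto (𝓝[>] a)
    have hev : ∀ᶠ n in atTop, a < u n := hu.eventually self_mem_nhdsWithin
    obtain ⟨N, hN⟩ := eventually_atTop.mp hev
    have hu' : Tendsto (fun n => u (n + N)) atTop (𝓝[>] a) := hu.comp (tendsto_add_atTop_nat N)
    exact ⟨fun n => u (n + N), fun n => (hN _ (Nat.le_add_left N n)).le,
      hu'.mono_right nhdsWithin_le_nhds,
      fun χ => ((boundedVariationOn_step χ a).tendsto_rightLim a).comp hu'⟩

/-- The mass that a functional on `D([0,1])` puts on the point `a`: the limit of its values at the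
indicator functions of `[a, b)` as `b` decreases to `a`. At `a = 1` it is `0` by the convention for
`Function.rightLim`. -/
def jump (a : unitInterval) : StrongDual ℝ (StrongDual ℝ (D 1)) :=
  LinearMap.mkContinuous
    { toFun := fun χ => Function.rightLim (fun b => χ (step a - step b)) a
      map_add' := fun χ ψ => by
        obtain ⟨u, -, -, hu⟩ := exists_seq_tendsto_jump a
        exact tendsto_nhds_unique (hu (χ + ψ)) ((hu χ).add (hu ψ))
      map_smul' := fun c χ => by
        obtain ⟨u, -, -, hu⟩ := exists_seq_tendsto_jump a
        exact tendsto_nhds_unique (hu (c • χ)) ((hu χ).const_mul c) } 1 fun χ => by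
    obtain ⟨u, hau, -, hu⟩ := exists_seq_tendsto_jump a
    refine le_of_tendsto (hu χ).norm (Eventually.of_forall fun n => ?_)
    rw [one_mul]
    refine (χ.le_opNorm _).trans (mul_le_of_le_one_right (norm_nonneg _) ?_)
    have h := norm_sum_step_sub_step_le {()} (a := fun _ => a) (b := fun _ => u n)
      (fun _ _ => hau n) (fun i _ j _ hij => absurd (Subsingleton.elim i j) hij)
      (ε := fun _ => 1) (by simp)
    rwa [Finset.sum_singleton, one_smul] at h

theorem tendsto_jump (χ : StrongDual ℝ (D 1)) (a : unitInterval) :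
    Tendsto (fun b => χ (step a - step b)) (𝓝[>] a) (𝓝 (jump a χ)) :=
  (boundedVariationOn_step χ a).tendsto_rightLim a

theorem unconditionallyBounded_jump : UnconditionallyBounded jump 1 := by
  intro F ε hε
  refine ContinuousLinearMap.opNorm_le_bound _ zero_le_one fun χ => ?_
  rw [one_mul]
  choose u hau hua hu using exists_seq_tendsto_jump
  have hlim : Tendsto (fun n => χ (∑ a ∈ F, ε a • (step a - step (u a n)))) atTop
      (𝓝 ((∑ a ∈ F, ε a • jump a) χ)) := by
    have h1 : (∑ a ∈ F, ε a • jump a) χ = ∑ a ∈ F, ε a * jump a χ := by simp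
    rw [h1]
    simp only [map_sum, map_smul, smul_eq_mul]
    exact tendsto_finsetSum _ fun a _ => (hu a χ).const_mul (ε a)
  have hdisj : ∀ᶠ n in atTop, ∀ a ∈ F, ∀ b ∈ F, a < b → u a n ≤ b := by
    refine (Finset.eventually_all F).mpr fun a _ => (Finset.eventually_all F).mpr fun b _ => ?_
    by_cases hab : a < b
    · exact ((hua a).eventually (gt_mem_nhds hab)).mono fun n hn _ => hn.le
    · exact Eventually.of_forall fun n h => absurd h hab
  refine le_of_tendsto hlim.norm (hdisj.mono fun n hn => ?_)
  refine (χ.le_opNorm _).trans (mul_le_of_le_one_right (norm_nonneg _)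
    (norm_sum_step_sub_step_le F (fun a _ => hau a n) (fun a ha b hb hab => ?_) hε))
  rcases lt_or_gt_of_ne hab with h | h
  · exact Or.inl (hn a ha b hb h)
  · exact Or.inr (hn b hb a ha h)

/-- The masses of points, together with the evaluations at `step (q k)`, scaled to be summable. -/
def bidualFamily (q : ℕ → unitInterval) : ℕ ⊕ unitInterval → StrongDual ℝ (StrongDual ℝ (D 1)) :=
  Sum.elim (fun k => ((1 : ℝ) / 2) ^ k • NormedSpace.inclusionInDoubleDual ℝ (D 1) (step (q k)))
    jump

theorem norm_step_le (a : unitInterval) : ‖step a‖ ≤ 1 :=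
  D.norm_le fun t => by rw [step_apply]; split_ifs <;> simp

theorem unconditionallyBounded_bidualFamily (q : ℕ → unitInterval) :
    UnconditionallyBounded (bidualFamily q) (2 + 1) :=
  (unconditionallyBounded_geometric fun k =>
    (NormedSpace.double_dual_bound ℝ (D 1) (step (q k))).trans (norm_step_le _)).sumElim
    unconditionallyBounded_jump

theorem exists_mem_range_Ioo {q : ℕ → unitInterval} (hq : DenseRange q) {a b : unitInterval}
    (hab : a < b) : ∃ k, q k ∈ Ioo a b :=
  hq.exists_mem_open isOpen_Ioo (nonempty_Ioo.mpr hab)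

/-- A functional without atoms that vanishes at `step (q k)` for a dense sequence `q` is zero. -/
theorem eq_zero_of_bidualFamily_eq_zero {q : ℕ → unitInterval} (hq : DenseRange q)
    (h1 : 1 ∈ range q) (χ : StrongDual ℝ (D 1)) (hχ : ∀ i, bidualFamily q i χ = 0) : χ = 0 := by
  have hk : ∀ k, χ (step (q k)) = 0 := fun k => by
    have h := hχ (Sum.inl k)
    rw [bidualFamily, Sum.elim_inl, smul_apply, smul_eq_zero] at h
    exact h.resolve_left (by positivity)
  have hj : ∀ a, jump a χ = 0 := fun a => hχ (Sum.inr a)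
  have hstep : ∀ a, χ (step a) = 0 := by
    intro a
    rcases eq_or_ne a 1 with rfl | ha
    · obtain ⟨k, hk1⟩ := h1
      rw [← hk1, hk]
    · have ha1 : a < 1 := lt_of_le_of_ne unitInterval.le_one' ha
      by_contra hne
      have hlim := tendsto_jump χ a
      rw [hj a] at hlim
      obtain ⟨b, hb, hab⟩ := (mem_nhdsGT_iff_exists_Ioo_subset' ha1).mp
        (hlim.eventually_ne (Ne.symm hne))
      obtain ⟨k, hkab⟩ := exists_mem_range_Ioo hq hb
      exact hab hkab (by rw [map_sub, hk, sub_zero])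
  refine ContinuousLinearMap.ext_on dense_span_range_step ?_
  rintro _ ⟨a, rfl⟩
  exact hstep a

/-! ### Sampling along a dense sequence -/

/-- The point `0` and the first `n` points of a sequence. -/
def grid (q : ℕ → unitInterval) (n : ℕ) : Finset unitInterval :=
  insert 0 ((Finset.range n).image q)

theorem zero_mem_grid (q : ℕ → unitInterval) (n : ℕ) : 0 ∈ grid q n :=
  Finset.mem_insert_self _ _

theorem mem_grid {q : ℕ → unitInterval} {k n : ℕ} (h : k < n) : q k ∈ grid q n :=
  Finset.mem_insert_of_mem (Finset.mem_image_of_mem q (Finset.mem_range.mpr h))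

/-- Rounding down to a grid turns `[a, 1]` into `[c, 1]`, where `c` is the first grid point in
`[a, 1]`. -/
theorem sample_step {P : Finset unitInterval} {a c : unitInterval} (h0 : 0 ∈ P) (hc : c ∈ P)
    (hac : a ≤ c) (hmin : ∀ p ∈ P, a ≤ p → c ≤ p) :
    sample (fun _ => some P) (step a) = step c := by
  ext t
  rw [sample_apply, step_apply, step_apply]
  change (if a ≤ floor P (t 0) then (1 : ℝ) else 0) = _
  have h : a ≤ floor P (t 0) ↔ c ≤ t 0 :=
    ⟨fun h => (hmin _ (floor_mem h0 _) h).trans (floor_le P _),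
      fun h => hac.trans (le_floor hc h)⟩
  simp only [h]

theorem tendsto_sample_step {q : ℕ → unitInterval} (hq : DenseRange q) (h0 : 0 ∈ range q)
    (h1 : 1 ∈ range q) {χ : StrongDual ℝ (D 1)} {a : unitInterval}
    (ha : a ∉ range q → jump a χ = 0) :
    Tendsto (fun n => χ (sample (fun _ => some (grid q n)) (step a) - step a)) atTop (𝓝 0) := by
  obtain ⟨k1, hk1⟩ := h1
  have hev : ∀ k, ∀ᶠ n in atTop, q k ∈ grid q n := fun k =>
    (eventually_gt_atTop k).mono fun n hn => mem_grid hn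
  by_cases haq : a ∈ range q
  · obtain ⟨k, rfl⟩ := haq
    refine tendsto_const_nhds.congr' ?_
    filter_upwards [hev k] with n hnk
    rw [sample_step (zero_mem_grid q n) hnk le_rfl fun _ _ h => h, sub_self, map_zero]
  · have hex : ∀ n, ∃ c, q k1 ∈ grid q n → c ∈ grid q n ∧ a ≤ c ∧ ∀ p ∈ grid q n, a ≤ p → c ≤ p := by
      intro n
      by_cases hn : q k1 ∈ grid q n
      · have hne : ((grid q n).filter (a ≤ ·)).Nonempty :=
          ⟨q k1, Finset.mem_filter.mpr ⟨hn, hk1 ▸ unitInterval.le_one'⟩⟩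
        have hmem := Finset.mem_filter.mp (Finset.min'_mem _ hne)
        exact ⟨_, fun _ => ⟨hmem.1, hmem.2,
          fun p hp hap => Finset.min'_le _ _ (Finset.mem_filter.mpr ⟨hp, hap⟩)⟩⟩
      · exact ⟨0, fun h => absurd h hn⟩
    choose c hc using hex
    have ha1 : a < 1 := lt_of_le_of_ne unitInterval.le_one' fun h => haq ⟨k1, hk1.trans h.symm⟩
    -- the grid points are dense, so the first one above `a` decreases to `a` without reaching it
    have hca : Tendsto c atTop (𝓝[>] a) := by
      refine (nhdsGT_basis_of_exists_gt ⟨1, ha1⟩).tendsto_right_iff.mpr fun b hb => ?_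
      obtain ⟨k, hk⟩ := exists_mem_range_Ioo hq hb
      filter_upwards [hev k1, hev k] with n hn1 hnk
      obtain ⟨h2, h3, h4⟩ := hc n hn1
      refine ⟨lt_of_le_of_ne h3 fun h => haq ?_, (h4 _ hnk hk.1.le).trans_lt hk.2⟩
      rcases Finset.mem_insert.mp (h ▸ h2) with h5 | h5
      · rwa [h5]
      · obtain ⟨j, -, hj⟩ := Finset.mem_image.mp h5
        exact ⟨j, hj⟩
    have hlim := ((tendsto_jump χ a).comp hca).neg
    rw [ha haq, neg_zero] at hlim
    refine hlim.congr' ?_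
    filter_upwards [hev k1] with n hn1
    obtain ⟨h2, h3, h4⟩ := hc n hn1
    rw [sample_step (zero_mem_grid q n) h2 h3 h4, Function.comp_apply, ← map_neg, neg_sub]

/-- If `q` exhausts the atoms of a functional, then the functional is the pointwise limit of its
values at the sampled functions. -/
theorem tendsto_sample {q : ℕ → unitInterval} (hq : DenseRange q) (h0 : 0 ∈ range q)
    (h1 : 1 ∈ range q) {χ : StrongDual ℝ (D 1)} (hχ : ∀ a ∉ range q, jump a χ = 0) (φ : D 1) :
    Tendsto (fun n => χ (sample (fun _ => some (grid q n)) φ - φ)) atTop (𝓝 0) := by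
  refine tendsto_zero_of_dense_span dense_span_range_step
    (lam := fun n => χ.toLinearMap ∘ₗ (sample (fun _ => some (grid q n)) - LinearMap.id))
    (C := ‖χ‖ * 2) (fun n x => ?_) ?_ φ
  · refine (χ.le_opNorm _).trans ?_
    rw [mul_assoc]
    refine mul_le_mul_of_nonneg_left ?_ (norm_nonneg _)
    refine (norm_sub_le _ _).trans ?_
    rw [two_mul]
    exact add_le_add (norm_sample_le _ x) le_rfl
  · rintro _ ⟨a, rfl⟩
    exact tendsto_sample_step hq h0 h1 (hχ a)

variable {ℓ : ℕ}

/-! ### Measurability of bounded multilinear forms -/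

theorem measurable_eval (t : Cube m) : Measurable fun f : D m => f t :=
  measurable_iff_comap_le.mpr
    (le_iSup (fun t : Cube m => MeasurableSpace.comap (fun f : D m => f t) (borel ℝ)) t)

/-- The form on functions of one variable obtained by evaluating a bounded multilinear form on
`D([0,1]^m)` at tensor products. -/
theorem exists_form_tensor {Υ : MultilinearMap ℝ (fun _ : Fin ℓ => D m) ℝ}
    (hΥ : IsBoundedMultilinear Υ) :
    ∃ Ψ : ContinuousMultilinearMap ℝ (fun _ : (Σ _ : Fin ℓ, Fin m) => D 1) ℝ,
      ∀ φ, Ψ φ = Υ fun j => tensor m fun i => φ ⟨j, i⟩ := by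
  obtain ⟨C, hC⟩ := hΥ
  refine ⟨(Υ.compMultilinearMap fun _ => tensor m).mkContinuous |C| fun φ => ?_, fun φ => rfl⟩
  refine (hC _).trans (mul_le_mul (le_abs_self C) ?_ (Finset.prod_nonneg fun _ _ => norm_nonneg _)
    (abs_nonneg C))
  rw [Fintype.prod_sigma]
  exact Finset.prod_le_prod (fun _ _ => norm_nonneg _) fun j _ => norm_tensor_le _

theorem exists_dense_seq_range_superset {A : Set unitInterval} (hA : A.Countable) :
    ∃ q : ℕ → unitInterval, DenseRange q ∧ 0 ∈ range q ∧ 1 ∈ range q ∧ A ⊆ range q := by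
  obtain ⟨d, hd, hdense⟩ := TopologicalSpace.exists_countable_dense unitInterval
  obtain ⟨q, hq⟩ := (((hd.union hA).insert 1).insert 0).exists_eq_range ⟨0, mem_insert _ _⟩
  refine ⟨q, hdense.mono ?_, ?_, ?_, ?_⟩ <;> rw [← hq]
  · exact fun x hx => Or.inr (Or.inr (Or.inl hx))
  · exact mem_insert _ _
  · exact Or.inr (mem_insert _ _)
  · exact fun x hx => Or.inr (Or.inr (Or.inr hx))

/-- Only countably many points carry mass for one of the variables of a bounded multilinear form,
whatever the other variables are. -/
theorem countable_setOf_jump_ne_zero {ι : Type*} [Fintype ι] [DecidableEq ι]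
    (Ψ : ContinuousMultilinearMap ℝ (fun _ : ι => D 1) ℝ) (k : ι) :
    {a | ∃ φ : ι → D 1, jump a (Ψ.toContinuousLinearMap φ k) ≠ 0}.Countable := by
  obtain ⟨q, hq, -, h1, -⟩ := exists_dense_seq_range_superset countable_empty
  exact (countable_setOf_bidual_ne_zero (unconditionallyBounded_bidualFamily q)
    (eq_zero_of_bidualFamily_eq_zero hq h1) Ψ k).preimage Sum.inr_injective

/-- Sampling one coordinate of one argument along a sequence that contains the atoms of the form in
that coordinate. -/
theorem tendsto_form_sample {Υ : MultilinearMap ℝ (fun _ : Fin ℓ => D m) ℝ}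
    (hΥ : IsBoundedMultilinear Υ)
    {Ψ : ContinuousMultilinearMap ℝ (fun _ : (Σ _ : Fin ℓ, Fin m) => D 1) ℝ}
    (hΨ : ∀ φ, Ψ φ = Υ fun j => tensor m fun i => φ ⟨j, i⟩)
    {q : ℕ → unitInterval} (hq : DenseRange q) (h0 : 0 ∈ range q) (h1 : 1 ∈ range q)
    (hatom : ∀ k φ, ∀ a ∉ range q, jump a (Ψ.toContinuousLinearMap φ k) = 0)
    (j₀ : Fin ℓ) (i₀ : Fin m) (g : Fin ℓ → D m) :
    Tendsto (fun n => Υ (Function.update g j₀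
      (sample (Function.update (fun _ => none) i₀ (some (grid q n))) (g j₀)))) atTop
      (𝓝 (Υ g)) := by
  set S : ℕ → D m →ₗ[ℝ] D m :=
    fun n => sample (Function.update (fun _ => none) i₀ (some (grid q n))) with hS
  -- the error of sampling is itself a multilinear form, to be tested on tensor products
  set L : ℕ → Fin ℓ → D m →ₗ[ℝ] D m :=
    fun n j => if j = j₀ then S n - LinearMap.id else LinearMap.id with hL
  have hupdate : ∀ n (g : Fin ℓ → D m),
      (fun j => L n j (g j)) = Function.update g j₀ (S n (g j₀) - g j₀) := by
    intro n g
    ext1 j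
    by_cases hj : j = j₀
    · subst hj; simp [hL]
    · simp [hL, hj]
  have hdiff : Tendsto (fun n => Υ.compLinearMap (L n) g) atTop (𝓝 0) := by
    obtain ⟨C, hC⟩ := hΥ
    refine tendsto_zero_multilinear_of_dense_span (dense_span_range_tensor m)
      (C := |C| * ∏ _j : Fin ℓ, 2) (fun n g => ?_) (fun g hg => ?_) g
    · rw [MultilinearMap.compLinearMap_apply, mul_assoc, ← Finset.prod_mul_distrib]
      refine (hC _).trans (mul_le_mul (le_abs_self C) ?_
        (Finset.prod_nonneg fun _ _ => norm_nonneg _) (abs_nonneg C))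
      refine Finset.prod_le_prod (fun _ _ => norm_nonneg _) fun j _ => ?_
      rw [two_mul]
      by_cases hj : j = j₀
      · simp only [hL, hj, if_true]
        exact (norm_sub_le _ _).trans (add_le_add (norm_sample_le _ _) le_rfl)
      · simp only [hL, hj, if_false]
        exact le_add_of_nonneg_left (norm_nonneg _)
    · choose φ hφ using hg
      have h := tendsto_sample hq h0 h1 (hatom ⟨j₀, i₀⟩ fun k => φ k.1 k.2) (φ j₀ i₀)
      refine h.congr fun n => ?_
      rw [MultilinearMap.compLinearMap_apply, hupdate]
      change Ψ (Function.update _ _ _) = _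
      rw [hΨ]
      congr 1
      ext1 j
      by_cases hj : j = j₀
      · subst hj
        rw [Function.update_self, ← hφ, hS]
        have e1 : (fun i => Function.update (fun k : (Σ _ : Fin ℓ, Fin m) => φ k.1 k.2) ⟨j, i₀⟩
            (sample (fun _ => some (grid q n)) (φ j i₀) - φ j i₀) ⟨j, i⟩) =
            Function.update (φ j) i₀
              (sample (fun _ => some (grid q n)) (φ j i₀) - φ j i₀) := by
          ext1 i
          by_cases hi : i = i₀
          · subst hi; simp
          · have hne : (⟨j, i⟩ : (Σ _ : Fin ℓ, Fin m)) ≠ ⟨j, i₀⟩ := fun h => hi (by simpa using h)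
            simp [hi, hne]
        rw [e1, MultilinearMap.map_update_sub, Function.update_eq_self]
        congr 1
        rw [sample_tensor]
        congr 1
        ext1 i
        by_cases hi : i = i₀
        · subst hi; simp
        · simp only [Function.update_of_ne hi]
          rfl
      · rw [Function.update_of_ne hj, ← hφ]
        congr 1
        ext1 i
        have hne : (⟨j, i⟩ : (Σ _ : Fin ℓ, Fin m)) ≠ ⟨j₀, i₀⟩ :=
          fun h => hj (congrArg Sigma.fst h)
        rw [Function.update_of_ne hne]
  refine (tendsto_sub_nhds_zero_iff.mp (hdiff.congr fun n => ?_))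
  rw [MultilinearMap.compLinearMap_apply, hupdate, MultilinearMap.map_update_sub,
    Function.update_eq_self]

/-- On functions that are sampled in every coordinate, a multilinear form is a polynomial in
finitely many point evaluations. -/
theorem measurable_form_sample_grid (Υ : MultilinearMap ℝ (fun _ : Fin ℓ => D m) ℝ)
    (P : Fin ℓ → Fin m → Finset unitInterval) (h0 : ∀ j i, 0 ∈ P j i) :
    Measurable fun f : Fin ℓ → D m => Υ fun j => sample (fun i => some (P j i)) (f j) := by
  classical
  choose b _ hb using fun j => exists_sample_eq_sum (P j) (h0 j)
  have h : ∀ f : Fin ℓ → D m, (Υ fun j => sample (fun i => some (P j i)) (f j)) =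
      ∑ p ∈ Fintype.piFinset fun j => Fintype.piFinset (P j),
        (∏ j, f j (p j)) * Υ fun j => tensor m (b j (p j)) := by
    intro f
    simp only [hb]
    rw [MultilinearMap.map_sum_finset]
    refine Finset.sum_congr rfl fun p _ => ?_
    rw [MultilinearMap.map_smul_univ, smul_eq_mul]
  simp only [h]
  refine Finset.measurable_sum _ fun p _ => Measurable.mul_const ?_ _
  exact Finset.measurable_prod _ fun j _ => (measurable_eval (p j)).comp (measurable_pi_apply j)

theorem measurable_of_isBoundedMultilinear {Υ : MultilinearMap ℝ (fun _ : Fin ℓ => D m) ℝ}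
    (hΥ : IsBoundedMultilinear Υ) : Measurable fun f : Fin ℓ → D m => Υ f := by
  obtain ⟨Ψ, hΨ⟩ := exists_form_tensor hΥ
  obtain ⟨q, hq, h0, h1, hsub⟩ := exists_dense_seq_range_superset
    (countable_iUnion fun k => countable_setOf_jump_ne_zero Ψ k)
  have hatom : ∀ k φ, ∀ a ∉ range q, jump a (Ψ.toContinuousLinearMap φ k) = 0 :=
    fun k φ a ha => by_contra fun h => ha (hsub (mem_iUnion.mpr ⟨k, φ, h⟩))
  -- induction on the coordinates that are not rounded, one limit for each of them
  suffices H : ∀ (A : Finset (Σ _ : Fin ℓ, Fin m)) (r : Fin ℓ → Fin m → Option ℕ),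
      (∀ j i, r j i = none → ⟨j, i⟩ ∈ A) →
        Measurable fun f : Fin ℓ → D m =>
          Υ fun j => sample (fun i => (r j i).map (grid q)) (f j) from
    H Finset.univ (fun _ _ => none) (by simp)
  intro A
  induction A using Finset.induction_on with
  | empty =>
    intro r hr
    choose n hn using fun j i => Option.ne_none_iff_exists'.mp fun h => by simpa using hr j i h
    simp only [hn, Option.map_some]
    exact measurable_form_sample_grid Υ _ fun _ _ => zero_mem_grid q _
  | insert k A _ ih =>
    intro r hr
    obtain ⟨j₀, i₀⟩ := k
    by_cases hk : r j₀ i₀ = none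
    · set r' : ℕ → Fin ℓ → Fin m → Option ℕ := fun n =>
        Function.update r j₀ (Function.update (r j₀) i₀ (some n)) with hr'
      refine measurable_of_tendsto_metrizable (f := fun n (f : Fin ℓ → D m) =>
        Υ fun j => sample (fun i => (r' n j i).map (grid q)) (f j)) (fun n => ?_) ?_
      · refine ih _ fun j i hji => ?_
        have hne : (⟨j, i⟩ : (Σ _ : Fin ℓ, Fin m)) ≠ ⟨j₀, i₀⟩ := by
          rintro h
          cases h
          simp [hr'] at hji
        have hji' : r j i = none := by
          by_cases hj : j = j₀
          · subst hj
            have hi : i ≠ i₀ := fun h => hne (by rw [h])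
            simpa [hr', hi] using hji
          · simpa [hr', hj] using hji
        exact (Finset.mem_insert.mp (hr j i hji')).resolve_left hne
      · refine tendsto_pi_nhds.mpr fun f => ?_
        refine (tendsto_form_sample hΥ hΨ hq h0 h1 hatom j₀ i₀
          (fun j => sample (fun i => (r j i).map (grid q)) (f j))).congr fun n => ?_
        congr 1
        ext1 j
        by_cases hj : j = j₀
        · subst hj
          rw [Function.update_self]
          ext s
          simp only [sample_apply]
          congr 1
          ext1 i
          by_cases hi : i = i₀
          · subst hi
            simp [hr', hk, rounding]
          · simp [hr', hi, rounding]
        · simp [hr', hj]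
    · refine ih r fun j i hji => (Finset.mem_insert.mp (hr j i hji)).resolve_left fun h => hk ?_
      cases h
      exact hji

theorem measurable_strongDual (χ : StrongDual ℝ (D m)) : Measurable fun f : D m => χ f := by
  have hbound : IsBoundedMultilinear
      (MultilinearMap.ofSubsingleton ℝ (D m) ℝ (0 : Fin 1) χ.toLinearMap) :=
    ⟨‖χ‖, fun f => by simpa using χ.le_opNorm (f 0)⟩
  exact (measurable_of_isBoundedMultilinear hbound).comp
    (measurable_pi_lambda (fun f (_ : Fin 1) => f) fun _ => measurable_id)

/-- The point evaluation at `t` as a continuous linear functional. -/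
def evalDual (t : Cube m) : StrongDual ℝ (D m) :=
  LinearMap.mkContinuous { toFun := fun f => f t, map_add' := fun _ _ => rfl,
                           map_smul' := fun _ _ => rfl } 1 fun f => by
    rw [one_mul]
    exact D.abs_apply_le_norm f t

theorem measurableSpace_eq_weakSigmaField (m : ℕ) :
    D.measurableSpace (m := m) = weakSigmaField (D m) := by
  apply le_antisymm
  · exact iSup_le fun t => le_iSup
      (fun χ : StrongDual ℝ (D m) => MeasurableSpace.comap (fun f : D m => χ f) (borel ℝ))
      (evalDual t)
  · exact iSup_le fun χ => measurable_iff_comap_le.mp (measurable_strongDual χ)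

theorem measurable_iff_weaklyMeasurable {Ω : Type*} [MeasurableSpace Ω] (X : Ω → D m) :
    Measurable X ↔ WeaklyMeasurable X := by
  refine ⟨fun hX χ => (measurable_strongDual χ).comp hX, fun hX => ?_⟩
  refine measurable_iff_comap_le.mpr ?_
  rw [D.measurableSpace, MeasurableSpace.comap_iSup]
  refine iSup_le fun t => ?_
  rw [MeasurableSpace.comap_comp]
  exact measurable_iff_comap_le.mp (hX (evalDual t))

end CadlagCube

end

theorem theorem5p1 (m : ℕ) (hm : 1 ≤ m) :
    (∀ ℓ : ℕ, 1 ≤ ℓ → ∀ Υ : MultilinearMap ℝ (fun _ : Fin ℓ => CadlagCube.D m) ℝ,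
      CadlagCube.IsBoundedMultilinear Υ →
        Measurable fun f : Fin ℓ → CadlagCube.D m => Υ f) ∧
    (∀ χ : StrongDual ℝ (CadlagCube.D m), Measurable fun f : CadlagCube.D m => χ f) ∧
    (CadlagCube.D.measurableSpace (m := m) = CadlagCube.weakSigmaField (CadlagCube.D m)) ∧
    (∀ (Ω : Type*) [MeasurableSpace Ω] (P : MeasureTheory.Measure Ω)
      [MeasureTheory.IsProbabilityMeasure P] (X : Ω → CadlagCube.D m),
      Measurable X ↔ CadlagCube.WeaklyMeasurable X) :=
  ⟨fun _ _ _ hΥ => CadlagCube.measurable_of_isBoundedMultilinear hΥ,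
    CadlagCube.measurable_strongDual, CadlagCube.measurableSpace_eq_weakSigmaField m,
    fun _ _ _ _ X => CadlagCube.measurable_iff_weaklyMeasurable X⟩
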